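/- Let $N\ge 2$, $n\ge 0$ and $L>n$ be integers and $\omega=e^{2\pi i/N}$. On the periodic chain of $\mathbb{Z}_N$ qudits with sites $j\in\mathbb{Z}/L$ and Hilbert space $(\mathbb{C}^N)^{\otimes L}$ with basis $|k\rangle$, $k\in\mathbb{Z}_N^L$, let $\mathcal Z_j|k\rangle=\omega^{k_j}|k\rangle$ and $\mathcal X_j|k\rangle=|k+e_j\rangle$, and let $M$ be the reflection operator $j\mapsto -j$. Let $\Delta_{j,\ell}\in\mathbb{Z}_N$ be translation invariant ($\Delta_{j+k,\ell+k}=\Delta_{j,\ell}$), with $\Delta_{j,\ell}=0$ unless $\ell\in\{j,j+1,\dots,j+n\}$, and with $\Delta_{1,1}$ and $\Delta_{1,1+n}$ coprime to $N$. For $q=1,\dots,n$ let $f^{(q)}:\mathbb{Z}\to\mathbb{Z}_N$ be the solution of $\sum_{k=0}^n\Delta_{1,1+k}f_{j+k}=0$ (all $j\in\mathbb Z$) with $f^{(q)}_j=\delta_{j,q}$ for $1\le j\le n$; assume $f^{(q)}_{j+L}=f^{(q)}_j$ for all $q$ and $j$, and put $U_q=\prod_j\mathcal X_j^{f^{(q)}_j}$.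 Let $$H=-\sum_j\Big\{J\prod_\ell\mathcal Z_\ell^{\Delta_{j,\ell}}+h\,\mathcal X_j+\mathrm{H.c.}\Big\},\qquad J,h\in\mathbb{R}.$$ Let $\mathfrak H$ be the product over all sites of the single-site Hadamard operators with entries $N^{-1/2}\omega^{-\alpha\beta}$, and $\mathsf C=\mathfrak H^2$. Let $\tilde{\mathsf D}_{\mathrm{KW}}$ be the operator with entries $$\langle m|\tilde{\mathsf D}_{\mathrm{KW}}|k\rangle=N^{-L/2}\,\omega^{-\sum_{j,\ell}m_j\Delta_{j,\ell}k_\ell},$$ and $\mathsf D_{\mathrm M}=M\,\tilde{\mathsf D}_{\mathrm{KW}}$. Then: 1. $\tilde{\mathsf D}_{\mathrm{KW}}$ implements the Kramers-Wannier transformation $$\tilde{\mathsf D}_{\mathrm{KW}}\prod_\ell\mathcal Z_\ell^{\Delta_{j,\ell}}=\mathcal X_j\,\tilde{\mathsf D}_{\mathrm{KW}},\qquad \tilde{\mathsf D}_{\mathrm{KW}}\,\mathcal X_j=\prod_\ell\mathcal Z_\ell^{-\Delta^{\mathsf T}_{j,\ell}}\,\tilde{\mathsf D}_{\mathrm{KW}}\qquad\text{for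 all }j,$$ and every operator that satisfies these relations is a scalar multiple of it. 2. For all $j$, $$\mathsf D_{\mathrm M}\prod_\ell\mathcal Z_\ell^{\Delta_{j,\ell}}=\mathcal X_{-j}\,\mathsf D_{\mathrm M},\qquad \mathsf D_{\mathrm M}\,\mathcal X_j=\prod_\ell\mathcal Z_\ell^{-\Delta_{-j,\ell}}\,\mathsf D_{\mathrm M}.$$ 3. $\mathsf D_{\mathrm M}$ commutes with $H$ whenever $J=h$ (no reflection symmetry of $H$ is assumed). 4. $\displaystyle \mathsf D_{\mathrm M}\mathsf D_{\mathrm M}=\mathsf C\prod_{q=1}^n\sum_{a=0}^{N-1}U_q^a$, $\ \mathsf D_{\mathrm M}^\dagger=\mathsf D_{\mathrm M}\mathsf C$, and $U_q\mathsf D_{\mathrm M}=\mathsf D_{\mathrm M}U_q=\mathsf D_{\mathrm M}$ for all $q$. 5. $\mathsf C$ is unitary and is charge conjugation: $\mathsf C\mathcal X_j\mathsf C^\dagger=\mathcal X_j^\dagger$ and $\mathsf C\mathcal Z_j\mathsf C^\dagger=\mathcal Z_j^\dagger$ for all $j$. 6. If $n\ge 1$, then $\mathsf D_{\mathrm M}$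 is not invertible. -/

import Mathlib

open scoped Matrix

noncomputable section

namespace ModulatedIsing

/-- A basis configuration of `ℤ_N` qudits on the periodic chain `j ∼ j + L`. -/
abbrev Config (N L : ℕ) : Type := ZMod L → ZMod N

/-- Operators on `⨂_j ℂ^N`, written as matrices in the orthonormal basis of `𝒵`-eigenstates:
`A m k = ⟨m| A |k⟩`. The adjoint is the conjugate transpose. -/
abbrev Op (N L : ℕ) : Type := Matrix (Config N L) (Config N L) ℂ

/-- The shift operator `𝒳_j`, adding `1` to the qudit at site `j`. -/
def shiftX (N L : ℕ) [NeZero N] [NeZero L] (j : ZMod L) : Op N L :=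
  Matrix.of fun m k => if m = k + Pi.single j 1 then 1 else 0

/-- The clock operator `𝒵_j`, with `𝒵_j |k⟩ = ω^{k_j} |k⟩` and `ω = exp (2πi / N)`. -/
def clockZ (N L : ℕ) [NeZero N] [NeZero L] (j : ZMod L) : Op N L :=
  Matrix.diagonal fun k => ZMod.stdAddChar (k j)

/-- `∏_j 𝒳_j ^ f_j`; the exponents matter modulo `N` only, and the factors commute. -/
def prodX {N L : ℕ} [NeZero N] [NeZero L] (f : ZMod L → ZMod N) : Op N L :=
  (List.ofFn fun i : Fin L => shiftX N L (i.val : ZMod L) ^ (f (i.val : ZMod L)).val).prod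

/-- `∏_ℓ 𝒵_ℓ ^ v_ℓ`; the exponents matter modulo `N` only, and the factors commute. -/
def prodZ {N L : ℕ} [NeZero N] [NeZero L] (v : ZMod L → ZMod N) : Op N L :=
  (List.ofFn fun i : Fin L => clockZ N L (i.val : ZMod L) ^ (v (i.val : ZMod L)).val).prod

/-- The site-centred reflection operator `M`, sending site `j` to `-j`. -/
def reflM (N L : ℕ) [NeZero N] [NeZero L] : Op N L :=
  Matrix.of fun m k => if m = (fun j => k (-j)) then 1 else 0

/-- The Hadamard operator `𝔥 = ∏_j 𝔥_j`, the tensor product over all sites of the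
single-site operators with entries `N^{-1/2} ω^{-αβ}`. -/
def hadamard (N L : ℕ) [NeZero N] [NeZero L] : Op N L :=
  Matrix.of fun m k => ∏ j, ((Real.sqrt N : ℝ) : ℂ)⁻¹ * ZMod.stdAddChar (-(m j * k j))

/-- Charge conjugation `C = 𝔥²`. -/
def chargeC (N L : ℕ) [NeZero N] [NeZero L] : Op N L := hadamard N L ^ 2

/-- The coupling matrices of the generalized Ising models: translation invariant, supported on
`j ≤ ℓ ≤ j + n`, with both extremal coefficients invertible modulo `N`. -/
structure IsCoupling {N L : ℕ} (n : ℕ) (Δ : Matrix (ZMod L) (ZMod L) (ZMod N)) : Prop where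
  translation : ∀ j l k : ZMod L, Δ (j + k) (l + k) = Δ j l
  support : ∀ j l : ZMod L, n < (l - j).val → Δ j l = 0
  unit_first : IsUnit (Δ 1 1)
  unit_last : IsUnit (Δ 1 (1 + (n : ZMod L)))

/-- `f⁽¹⁾, …, f⁽ⁿ⁾` (here indexed by `q = 0, …, n - 1`) are the generating solutions on the
infinite chain of `Δ_{1,1} f_j + Δ_{1,2} f_{j+1} + ⋯ + Δ_{1,1+n} f_{j+n} = 0`, normalized by
`f⁽q⁾_j = δ_{j,q}` for `j = 1, …, n`. -/
structure IsGeneratingFamily {N L n : ℕ} (Δ : Matrix (ZMod L) (ZMod L) (ZMod N))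
    (f : Fin n → ℤ → ZMod N) : Prop where
  recurrence : ∀ (q : Fin n) (j : ℤ),
    ∑ k ∈ Finset.range (n + 1), Δ 1 (1 + (k : ZMod L)) * f q (j + (k : ℤ)) = 0
  initial : ∀ q i : Fin n, f q ((i.val : ℤ) + 1) = if i = q then 1 else 0

/-- The modulated symmetry operator `∏_j 𝒳_j ^ f_j` on the periodic chain, for an `L`-periodic
lattice function `f` on `ℤ`. -/
def symU {N L : ℕ} [NeZero N] [NeZero L] (f : ℤ → ZMod N) : Op N L :=
  prodX fun j : ZMod L => f (j.val : ℤ)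

/-- `∏_q ∑_{a=0}^{N-1} U_q ^ a` (the factors commute). -/
def symSum {N L n : ℕ} [NeZero N] [NeZero L] (f : Fin n → ℤ → ZMod N) : Op N L :=
  (List.ofFn fun q : Fin n => ∑ a ∈ Finset.range N, (symU (f q) : Op N L) ^ a).prod

/-- The generalized Ising Hamiltonian
`H = -∑_j { J ∏_ℓ 𝒵_ℓ ^ Δ_{j,ℓ} + h 𝒳_j + H.c. }`. -/
def hamiltonian {N L : ℕ} [NeZero N] [NeZero L] (Δ : Matrix (ZMod L) (ZMod L) (ZMod N))
    (J h : ℝ) : Op N L :=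
  -∑ j : ZMod L, ((J : ℂ) • prodZ (Δ j) + (h : ℂ) • shiftX N L j
    + ((J : ℂ) • prodZ (Δ j) + (h : ℂ) • shiftX N L j)ᴴ)

/-- `D` implements the Kramers-Wannier transformation:
`D ∏_ℓ 𝒵_ℓ ^ Δ_{j,ℓ} = 𝒳_j D` and `D 𝒳_j = ∏_ℓ 𝒵_ℓ ^ (-Δᵀ_{j,ℓ}) D`. -/
def ImplementsKW {N L : ℕ} [NeZero N] [NeZero L] (Δ : Matrix (ZMod L) (ZMod L) (ZMod N))
    (D : Op N L) : Prop :=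
  (∀ j, D * prodZ (Δ j) = shiftX N L j * D) ∧
    ∀ j, D * shiftX N L j = prodZ (fun l => -Δᵀ j l) * D

/-- The Kramers-Wannier operator on the periodic chain, with matrix entries
`N^{-L/2} ω^{-∑_{j,ℓ} m_j Δ_{j,ℓ} k_ℓ}`. -/
def kwOp {N L : ℕ} [NeZero N] [NeZero L] (Δ : Matrix (ZMod L) (ZMod L) (ZMod N)) : Op N L :=
  Matrix.of fun m k =>
    ((Real.sqrt N : ℝ) : ℂ)⁻¹ ^ L * ZMod.stdAddChar (-∑ j, ∑ l, m j * Δ j l * k l)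

/-- The non-invertible reflection operator `D_M = M D̃_KW`. -/
def dualRefl {N L : ℕ} [NeZero N] [NeZero L] (Δ : Matrix (ZMod L) (ZMod L) (ZMod N)) : Op N L :=
  reflM N L * kwOp Δ

end ModulatedIsing

end

open ModulatedIsing

/-!
All entries of `kwOp A` are characters of a bilinear form, `⟨m|kwOp A|k⟩ ∝ ω^{-m·Ak}`, for an
arbitrary matrix `A`. Translating `m` or `k` multiplies such an entry by a phase linear in the other
variable, which is the Kramers-Wannier transformation (`implementsKW_kwOp`); conversely that
transformation determines all entries from the one at `(0, 0)`, because unit vectors generate the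
configuration space (`eq_smul_kwOp_of_implementsKW`). Summing over the intermediate configuration,
orthogonality of characters makes `kwOp A * kwOp B` the indicator of the relation
`Aᵀ m + B k = 0` (`kwOp_mul_kwOp_apply`).

The two other operators of the theorem are of the same kind. The Hadamard operator is `kwOp 1`, so
its square is the permutation `k ↦ -k`. The reflection `D_M` is `kwOp S` with `S j l = Δ (-j) l`
(`dualRefl_eq_kwOp`), and translation invariance makes `S` symmetric
(`IsCoupling.transpose_reflectedCoupling`). The symmetry of `S` gives the action of `D_M` on the
terms of the Hamiltonian, where the remaining reflection of sites only permutes the sum, and the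
adjoint of `D_M`. It also shows that `D_M²` is the indicator of `Δ (m + k) = 0`.

It remains to see that the kernel of `Δ` on the periodic chain is freely generated by the periodic
generating solutions (`symSum_apply`): as `n < L`, the equation `Δ g = 0` is the recurrence, and as
the last coefficient is a unit, a solution is determined by its values on the sites `1, …, n`
(`IsCoupling.eq_zero_of_mulVec_eq_zero`). Finally `U_q D_M = D_M` with `U_q ≠ 1` excludes that `D_M`
is invertible.
-/

namespace ModulatedIsing

variable {N L : ℕ}

/-! ### The reflected coupling -/

/-- The coupling matrix of the reflected Kramers-Wannier operator, `S j l = Δ (-j) l`. -/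
def reflectedCoupling (Δ : Matrix (ZMod L) (ZMod L) (ZMod N)) :
    Matrix (ZMod L) (ZMod L) (ZMod N) :=
  Matrix.of fun j l => Δ (-j) l

/-- Translation invariance is all that is needed for the reflected coupling to be symmetric. -/
theorem IsCoupling.transpose_reflectedCoupling {n : ℕ} {Δ : Matrix (ZMod L) (ZMod L) (ZMod N)}
    (hΔ : IsCoupling n Δ) : (reflectedCoupling Δ)ᵀ = reflectedCoupling Δ := by
  ext j l
  have h := hΔ.translation (-l) j (l - j)
  simp only [Matrix.transpose_apply, reflectedCoupling, Matrix.of_apply]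
  rw [← h]
  congr 1 <;> abel

variable [NeZero L]

theorem reflectedCoupling_mulVec (Δ : Matrix (ZMod L) (ZMod L) (ZMod N)) (v : Config N L)
    (j : ZMod L) : (reflectedCoupling Δ *ᵥ v) j = (Δ *ᵥ v) (-j) := rfl

theorem reflectedCoupling_mulVec_eq_zero_iff {Δ : Matrix (ZMod L) (ZMod L) (ZMod N)}
    {v : Config N L} : reflectedCoupling Δ *ᵥ v = 0 ↔ Δ *ᵥ v = 0 := by
  simp only [funext_iff, reflectedCoupling_mulVec]
  exact (Equiv.neg (ZMod L)).forall_congr fun j => Iff.rfl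

/-! ### Periodic solutions of the recurrence -/

/-- On the periodic chain, `Δ g` is the finite recurrence of range `n`. -/
theorem IsCoupling.mulVec_apply {n : ℕ} {Δ : Matrix (ZMod L) (ZMod L) (ZMod N)}
    (hΔ : IsCoupling n Δ) (hnL : n < L) (g : Config N L) (j : ZMod L) :
    (Δ *ᵥ g) j = ∑ k ∈ Finset.range (n + 1), Δ 1 (1 + (k : ZMod L)) * g (j + (k : ZMod L)) := by
  have hval : ∀ k ∈ Finset.range (n + 1), ((k : ZMod L)).val = k := fun k hk => by
    rw [ZMod.val_natCast, Nat.mod_eq_of_lt]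
    have := Finset.mem_range.1 hk
    omega
  symm
  refine Finset.sum_of_injOn (fun k : ℕ => j + (k : ZMod L)) ?_ (by simp [Set.MapsTo]) ?_ ?_
  · intro a ha b hb h
    rw [← hval a ha, ← hval b hb, add_left_cancel h]
  · intro l _ hl
    change Δ j l * g l = 0
    rw [hΔ.support, zero_mul]
    by_contra! h
    refine hl ⟨(l - j).val, by simpa [Nat.lt_succ_iff] using h, ?_⟩
    simp
  · intro k _
    have h := hΔ.translation j (j + k) (1 - j)
    change _ = Δ j (j + k) * g (j + k)
    rw [← h]
    congr 2 <;> ring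

/-- A periodic solution of the recurrence that vanishes on the sites `1, …, n` vanishes: the
coefficient of its last term is a unit, so the zeros propagate around the chain. -/
theorem IsCoupling.eq_zero_of_mulVec_eq_zero {n : ℕ} {Δ : Matrix (ZMod L) (ZMod L) (ZMod N)}
    (hΔ : IsCoupling n Δ) (hnL : n < L) {g : Config N L} (hg : Δ *ᵥ g = 0)
    (h0 : ∀ i : Fin n, g ((i.val + 1 : ℕ) : ZMod L) = 0) : g = 0 := by
  -- It suffices to move in the direction of increasing sites, since every site is some `x + 1`.
  have key : ∀ x : ℕ, g ((x + 1 : ℕ) : ZMod L) = 0 := by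
    intro x
    induction x using Nat.strong_induction_on with
    | _ x ih =>
      rcases lt_or_ge x n with hx | hx
      · exact h0 ⟨x, hx⟩
      · have h := congrFun hg ((x - n + 1 : ℕ) : ZMod L)
        rw [hΔ.mulVec_apply hnL, Finset.sum_range_succ, Finset.sum_eq_zero, zero_add,
          Pi.zero_apply, hΔ.unit_last.mul_right_eq_zero, ← Nat.cast_add] at h
        · rwa [show x - n + 1 + n = x + 1 by omega] at h
        · intro k hk
          have hk := Finset.mem_range.1 hk
          rw [← Nat.cast_add, show x - n + 1 + k = (x - n + k) + 1 by omega, ih _ (by omega),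
            mul_zero]
  ext j
  simpa using key (j - 1).val

/-- The periodic lattice function `f`, as a configuration on the chain. -/
def toConfig (N L : ℕ) (f : ℤ → ZMod N) : Config N L := fun j => f (j.val : ℤ)

theorem toConfig_intCast {f : ℤ → ZMod N} (hf : ∀ j : ℤ, f (j + (L : ℤ)) = f j) (x : ℤ) :
    toConfig N L f (x : ZMod L) = f x := by
  have h := (show Function.Periodic f (L : ℤ) from hf).int_mul (x / L) (x % L)
  rw [toConfig, ZMod.val_intCast, ← h]
  congr 1
  exact (Int.emod_add_ediv_mul x L)

theorem IsGeneratingFamily.mulVec_toConfig {n : ℕ} {Δ : Matrix (ZMod L) (ZMod L) (ZMod N)}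
    (hΔ : IsCoupling n Δ) (hnL : n < L) {f : Fin n → ℤ → ZMod N} (hf : IsGeneratingFamily Δ f)
    (hper : ∀ (q : Fin n) (j : ℤ), f q (j + (L : ℤ)) = f q j) (q : Fin n) :
    Δ *ᵥ toConfig N L (f q) = 0 := by
  ext j
  rw [hΔ.mulVec_apply hnL, Pi.zero_apply, ← hf.recurrence q (j.val : ℤ)]
  refine Finset.sum_congr rfl fun k _ => ?_
  rw [← toConfig_intCast (hper q)]
  simp

theorem IsGeneratingFamily.toConfig_initial {n : ℕ} {Δ : Matrix (ZMod L) (ZMod L) (ZMod N)}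
    {f : Fin n → ℤ → ZMod N} (hf : IsGeneratingFamily Δ f)
    (hper : ∀ (q : Fin n) (j : ℤ), f q (j + (L : ℤ)) = f q j) (q i : Fin n) :
    toConfig N L (f q) ((i.val + 1 : ℕ) : ZMod L) = if i = q then 1 else 0 := by
  rw [← hf.initial q i, ← toConfig_intCast (hper q)]
  simp

theorem IsGeneratingFamily.sum_nsmul_initial {n : ℕ} {Δ : Matrix (ZMod L) (ZMod L) (ZMod N)}
    {f : Fin n → ℤ → ZMod N} (hf : IsGeneratingFamily Δ f)
    (hper : ∀ (q : Fin n) (j : ℤ), f q (j + (L : ℤ)) = f q j) (a : Fin n → ℕ) (i : Fin n) :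
    (∑ q, a q • toConfig N L (f q)) ((i.val + 1 : ℕ) : ZMod L) = a i := by
  simp only [Finset.sum_apply, Pi.smul_apply, hf.toConfig_initial hper]
  simp

/-! ### Translations and phases -/

/-- The operator `|k⟩ ↦ |k + v⟩`. -/
def translationOp (v : Config N L) : Op N L :=
  Matrix.of fun m k => if m = k + v then 1 else 0

theorem conjTranspose_translationOp (v : Config N L) :
    (translationOp v)ᴴ = translationOp (-v) := by
  ext m k
  have : k = m + v ↔ m = k + -v := by
    rw [← sub_eq_add_neg, eq_sub_iff_add_eq, eq_comm]
  by_cases h : k = m + v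
  · simp [translationOp, Matrix.conjTranspose_apply, h]
  · have h' := mt this.2 h
    simp only [translationOp, Matrix.conjTranspose_apply, Matrix.of_apply, if_neg h, if_neg h',
      star_zero]

theorem translationOp_ne_one {v : Config N L} (hv : v ≠ 0) : (translationOp v : Op N L) ≠ 1 := by
  intro h
  have := congrFun (congrFun h v) 0
  simp [translationOp, hv] at this

variable [NeZero N]

theorem translationOp_mul_apply (v : Config N L) (A : Op N L) (m k : Config N L) :
    (translationOp v * A) m k = A (m - v) k := by
  rw [Matrix.mul_apply, Finset.sum_eq_single (m - v)]
  · simp [translationOp]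
  · intro b _ hb
    have : m ≠ b + v := fun h => hb (by rw [h]; abel)
    simp [translationOp, this]
  · simp

theorem mul_translationOp_apply (v : Config N L) (A : Op N L) (m k : Config N L) :
    (A * translationOp v) m k = A m (k + v) := by
  rw [Matrix.mul_apply, Finset.sum_eq_single (k + v)]
  · simp [translationOp]
  · intro b _ hb
    simp [translationOp, hb]
  · simp

/-- Translations of the configuration space act on operators multiplicatively. -/
def translationHom : Multiplicative (Config N L) →* Op N L where
  toFun v := translationOp v.toAdd
  map_one' := by
    ext m k
    simp [translationOp, Matrix.one_apply]
  map_mul' v w := by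
    ext m k
    rw [mul_translationOp_apply]
    simp [translationOp, add_comm, add_left_comm]

theorem shiftX_eq (j : ZMod L) : shiftX N L j = translationOp (Pi.single j 1) := rfl

theorem stdAddChar_sum {ι : Type*} (s : Finset ι) (g : ι → ZMod N) :
    (ZMod.stdAddChar (∑ i ∈ s, g i) : ℂ) = ∏ i ∈ s, ZMod.stdAddChar (g i) :=
  (congrArg ZMod.stdAddChar.toMonoidHom (ofAdd_sum s g)).trans (map_prod _ _ _)

theorem sum_val_nsmul_single (v : Config N L) :
    ∑ j, (v j).val • (Pi.single j (1 : ZMod N) : Config N L) = v := by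
  ext j
  have h : ∀ i, ((v i).val • (Pi.single i (1 : ZMod N) : Config N L)) j =
      if j = i then v i else 0 := fun i => by
    rw [Pi.smul_apply, Pi.single_apply, smul_ite, smul_zero, nsmul_one, ZMod.natCast_zmod_val]
  simp_rw [Finset.sum_apply, h, Finset.sum_ite_eq, Finset.mem_univ, if_true]

/-- Summing over `Fin L` is summing over the sites of the chain. -/
theorem sum_fin_natCast {M : Type*} [AddCommMonoid M] (g : ZMod L → M) :
    ∑ i : Fin L, g (i.val : ZMod L) = ∑ j, g j := by
  refine Fintype.sum_bijective (fun i : Fin L => (i.val : ZMod L)) ?_ _ _ fun _ => rfl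
  refine (Fintype.bijective_iff_injective_and_card _).2 ⟨fun a b h => ?_, by simp⟩
  have := congrArg ZMod.val h
  simpa [ZMod.val_natCast, Nat.mod_eq_of_lt, Fin.val_inj] using this

theorem prodX_eq (v : Config N L) : prodX v = translationOp v := by
  have key : prodX v = translationHom (∏ i : Fin L,
      Multiplicative.ofAdd (Pi.single (i.val : ZMod L) (1 : ZMod N) : Config N L) ^
        (v (i.val : ZMod L)).val) := by
    rw [← List.prod_ofFn, map_list_prod, List.map_ofFn]
    simp only [prodX, Function.comp_def, map_pow]
    rfl
  rw [key]
  change translationOp (Multiplicative.toAdd _) = _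
  congr 1
  rw [toAdd_prod]
  simp only [toAdd_pow, toAdd_ofAdd]
  rw [sum_fin_natCast (fun j : ZMod L => (v j).val • (Pi.single j (1 : ZMod N) : Config N L)),
    sum_val_nsmul_single]

theorem prodZ_eq (v : Config N L) :
    prodZ v = Matrix.diagonal fun k : Config N L => (ZMod.stdAddChar (v ⬝ᵥ k) : ℂ) := by
  have key : (prodZ v : Op N L) = Matrix.diagonalRingHom (Config N L) ℂ (∏ i : Fin L,
      (fun k : Config N L => (ZMod.stdAddChar (k (i.val : ZMod L)) : ℂ)) ^
        (v (i.val : ZMod L)).val) := by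
    rw [← List.prod_ofFn, map_list_prod, List.map_ofFn]
    simp only [prodZ, Function.comp_def, map_pow]
    rfl
  rw [key, Matrix.diagonalRingHom_apply]
  congr 1
  ext k
  rw [Finset.prod_apply, dotProduct, ← sum_fin_natCast (fun j : ZMod L => v j * k j),
    stdAddChar_sum]
  refine Finset.prod_congr rfl fun i _ => ?_
  rw [Pi.pow_apply, ← AddChar.map_nsmul_eq_pow]
  simp

theorem conjTranspose_prodZ (v : Config N L) : (prodZ v : Op N L)ᴴ = prodZ (-v) := by
  rw [prodZ_eq, prodZ_eq, Matrix.diagonal_conjTranspose]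
  congr 1
  ext k
  simp [neg_dotProduct, AddChar.map_neg_eq_conj]

/-! ### Operators with a bilinear phase -/

theorem kwOp_apply (A : Matrix (ZMod L) (ZMod L) (ZMod N)) (m k : Config N L) :
    kwOp A m k = ((Real.sqrt N : ℝ) : ℂ)⁻¹ ^ L * ZMod.stdAddChar (-(m ⬝ᵥ A *ᵥ k)) := by
  simp [kwOp, dotProduct, Matrix.mulVec, Finset.mul_sum, mul_assoc]

/-- Translating the row index of `kwOp A` multiplies its entries by a phase in the column index;
the case of a unit vector is the first Kramers-Wannier relation. -/
theorem translationOp_mul_kwOp (A : Matrix (ZMod L) (ZMod L) (ZMod N)) (v : Config N L) :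
    translationOp v * kwOp A = kwOp A * prodZ (v ᵥ* A) := by
  ext m k
  rw [translationOp_mul_apply, prodZ_eq, Matrix.mul_diagonal, kwOp_apply, kwOp_apply, mul_assoc,
    ← AddChar.map_add_eq_mul, ← Matrix.dotProduct_mulVec, sub_dotProduct]
  congr 3
  abel

/-- Translating the column index of `kwOp A` multiplies its entries by a phase in the row index;
the case of a unit vector is the second Kramers-Wannier relation. -/
theorem kwOp_mul_translationOp (A : Matrix (ZMod L) (ZMod L) (ZMod N)) (v : Config N L) :
    kwOp A * translationOp v = prodZ (-(A *ᵥ v)) * kwOp A := by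
  ext m k
  rw [mul_translationOp_apply, prodZ_eq, Matrix.diagonal_mul, kwOp_apply, kwOp_apply,
    mul_left_comm, ← AddChar.map_add_eq_mul, Matrix.mulVec_add, dotProduct_add, neg_dotProduct,
    dotProduct_comm (A *ᵥ v)]
  congr 3
  abel

theorem prodZ_zero : (prodZ 0 : Op N L) = 1 := by
  simp [prodZ_eq, Matrix.diagonal_one]

theorem implementsKW_kwOp (A : Matrix (ZMod L) (ZMod L) (ZMod N)) : ImplementsKW A (kwOp A) := by
  refine ⟨fun j => ?_, fun j => ?_⟩
  · rw [shiftX_eq, translationOp_mul_kwOp, Matrix.single_one_vecMul]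
    rfl
  · rw [shiftX_eq, kwOp_mul_translationOp, Matrix.mulVec_single_one]
    rfl

theorem inv_sqrt_ne_zero : ((Real.sqrt N : ℝ) : ℂ)⁻¹ ≠ 0 := by
  simp [NeZero.ne N]

theorem inv_sqrt_pow_mul_self (r : ℕ) :
    (((Real.sqrt N : ℝ) : ℂ)⁻¹ ^ r * ((Real.sqrt N : ℝ) : ℂ)⁻¹ ^ r) * (N : ℂ) ^ r = 1 := by
  have h : ((Real.sqrt N : ℝ) : ℂ) * ((Real.sqrt N : ℝ) : ℂ) = N := by
    rw [← Complex.ofReal_mul, Real.mul_self_sqrt (Nat.cast_nonneg N), Complex.ofReal_natCast]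
  have hN : (N : ℂ) ≠ 0 := Nat.cast_ne_zero.2 (NeZero.ne N)
  rw [← mul_pow, ← mul_inv, h, ← mul_pow, inv_mul_cancel₀ hN, one_pow]

/-- The unit vectors generate the configuration space. -/
theorem closure_range_single :
    AddSubgroup.closure (Set.range fun j : ZMod L => (Pi.single j 1 : Config N L)) = ⊤ := by
  refine top_le_iff.1 fun v _ => ?_
  rw [← sum_val_nsmul_single v]
  exact sum_mem fun j _ => nsmul_mem (AddSubgroup.subset_closure (Set.mem_range_self j)) _

/-- A function on configurations that is invariant under the unit vectors is constant. -/
theorem apply_eq_apply_zero_of_add_single {α : Type*} (g : Config N L → α)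
    (hg : ∀ j k, g (k + Pi.single j 1) = g k) (k : Config N L) : g k = g 0 := by
  have hk : k ∈ AddSubgroup.closure (Set.range fun j : ZMod L => (Pi.single j 1 : Config N L)) := by
    rw [closure_range_single]
    trivial
  have := AddSubgroup.closure_induction (p := fun v _ => ∀ x, g (x + v) = g x)
    (by rintro _ ⟨j, rfl⟩ x; exact hg j x) (by simp)
    (fun v w _ _ hv hw x => by rw [← add_assoc, hw, hv])
    (fun v _ hv x => by rw [← hv, neg_add_cancel_right]) hk 0
  simpa using this

theorem eq_smul_kwOp_of_implementsKW {A : Matrix (ZMod L) (ZMod L) (ZMod N)} {D : Op N L}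
    (hD : ImplementsKW A D) : ∃ c : ℂ, D = c • kwOp A := by
  -- Stripping off the phase of `kwOp A` leaves an entry function invariant under all unit shifts.
  set E : Config N L → Config N L → ℂ := fun m k => D m k * ZMod.stdAddChar (m ⬝ᵥ A *ᵥ k)
    with hE
  have hrow : ∀ m k, E m k = E 0 k := by
    intro m k
    refine apply_eq_apply_zero_of_add_single (fun m => E m k) (fun j m => ?_) m
    have h := congrFun (congrFun (hD.1 j) (m + Pi.single j 1)) k
    rw [prodZ_eq, Matrix.mul_diagonal, shiftX_eq, translationOp_mul_apply, add_sub_cancel_right] at h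
    simp only [hE, ← h, add_dotProduct, single_one_dotProduct, AddChar.map_add_eq_mul,
      Matrix.mulVec]
    ring
  have hcol : ∀ m k, E m k = E m 0 := by
    intro m k
    refine apply_eq_apply_zero_of_add_single (fun k => E m k) (fun j k => ?_) k
    have h := congrFun (congrFun (hD.2 j) m) k
    rw [prodZ_eq, Matrix.diagonal_mul, shiftX_eq, mul_translationOp_apply] at h
    simp only [hE, h, Matrix.mulVec_add, dotProduct_add, Matrix.mulVec_single_one]
    rw [mul_right_comm, ← AddChar.map_add_eq_mul, mul_comm]
    congr 2
    have : (fun l => -Aᵀ j l) ⬝ᵥ m = -(m ⬝ᵥ A.col j) := by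
      rw [dotProduct_comm, ← dotProduct_neg]
      rfl
    rw [this]
    abel
  have hconst : ∀ m k, E m k = D 0 0 := fun m k => by
    rw [hrow, hcol]
    simp [hE]
  refine ⟨D 0 0 * (((Real.sqrt N : ℝ) : ℂ)⁻¹ ^ L)⁻¹, ?_⟩
  ext m k
  rw [Matrix.smul_apply, kwOp_apply, smul_eq_mul, ← hconst m k, mul_assoc,
    inv_mul_cancel_left₀ (pow_ne_zero _ inv_sqrt_ne_zero)]
  simp only [hE]
  rw [mul_assoc, ← AddChar.map_add_eq_mul, add_neg_cancel, AddChar.map_zero_eq_one, mul_one]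

/-- Orthogonality of the characters of the configuration space. -/
theorem sum_stdAddChar_dotProduct (v : Config N L) :
    ∑ p : Config N L, (ZMod.stdAddChar (v ⬝ᵥ p) : ℂ) = if v = 0 then (N : ℂ) ^ L else 0 := by
  have h : ∀ p : Config N L, (ZMod.stdAddChar (v ⬝ᵥ p) : ℂ) = ∏ j, ZMod.stdAddChar (p j * v j) :=
    fun p => by
      rw [dotProduct_comm, dotProduct, stdAddChar_sum]
  simp_rw [h]
  rw [← Fintype.prod_sum (fun j x => (ZMod.stdAddChar (x * v j) : ℂ))]
  simp_rw [AddChar.sum_mulShift _ (ZMod.isPrimitive_stdAddChar N)]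
  split_ifs with hv
  · simp [hv]
  · obtain ⟨j, hj⟩ := Function.ne_iff.1 hv
    exact Finset.prod_eq_zero (Finset.mem_univ j) (by simpa using fun h => absurd h hj)

/-- By orthogonality of characters, the product of two Kramers-Wannier operators is the indicator
of a linear relation. -/
theorem kwOp_mul_kwOp_apply (A B : Matrix (ZMod L) (ZMod L) (ZMod N)) (m k : Config N L) :
    (kwOp A * kwOp B) m k = if m ᵥ* A + B *ᵥ k = 0 then 1 else 0 := by
  have h : ∀ p : Config N L, kwOp A m p * kwOp B p k =
      (((Real.sqrt N : ℝ) : ℂ)⁻¹ ^ L * ((Real.sqrt N : ℝ) : ℂ)⁻¹ ^ L) *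
        ZMod.stdAddChar (-(m ᵥ* A + B *ᵥ k) ⬝ᵥ p) := fun p => by
    rw [kwOp_apply, kwOp_apply, mul_mul_mul_comm, ← AddChar.map_add_eq_mul, neg_dotProduct,
      add_dotProduct, Matrix.dotProduct_mulVec, dotProduct_comm p, neg_add]
  rw [Matrix.mul_apply]
  simp_rw [h]
  rw [← Finset.mul_sum, sum_stdAddChar_dotProduct, mul_ite, mul_zero, inv_sqrt_pow_mul_self]
  simp only [neg_eq_zero]

/-! ### Charge conjugation -/

theorem hadamard_eq_kwOp_one : hadamard N L = kwOp 1 := by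
  ext m k
  rw [kwOp_apply, Matrix.one_mulVec, dotProduct, ← Finset.sum_neg_distrib,
    stdAddChar_sum, hadamard, Matrix.of_apply, Finset.prod_mul_distrib,
    Finset.prod_const, Finset.card_univ, ZMod.card]

theorem chargeC_apply (m k : Config N L) : chargeC N L m k = if m = -k then 1 else 0 := by
  rw [chargeC, hadamard_eq_kwOp_one, sq, kwOp_mul_kwOp_apply, Matrix.vecMul_one,
    Matrix.one_mulVec]
  simp only [add_eq_zero_iff_eq_neg]

theorem chargeC_mul_apply (A : Op N L) (m k : Config N L) :
    (chargeC N L * A) m k = A (-m) k := by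
  rw [Matrix.mul_apply, Finset.sum_eq_single (-m)]
  · simp [chargeC_apply]
  · intro b _ hb
    have : m ≠ -b := fun h => hb (by rw [h, neg_neg])
    simp [chargeC_apply, this]
  · simp

theorem mul_chargeC_apply (A : Op N L) (m k : Config N L) :
    (A * chargeC N L) m k = A m (-k) := by
  rw [Matrix.mul_apply, Finset.sum_eq_single (-k)]
  · simp [chargeC_apply]
  · intro b _ hb
    simp [chargeC_apply, hb]
  · simp

theorem conjTranspose_chargeC : (chargeC N L)ᴴ = chargeC N L := by
  ext m k
  simp only [Matrix.conjTranspose_apply, chargeC_apply]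
  simp [apply_ite, eq_neg_iff_add_eq_zero, add_comm]

theorem chargeC_mul_self : chargeC N L * chargeC N L = 1 := by
  ext m k
  simp [chargeC_mul_apply, chargeC_apply, Matrix.one_apply]

theorem chargeC_mul_shiftX_mul_chargeC (j : ZMod L) :
    chargeC N L * shiftX N L j * chargeC N L = (shiftX N L j)ᴴ := by
  rw [shiftX_eq, conjTranspose_translationOp]
  ext m k
  rw [mul_chargeC_apply, chargeC_mul_apply]
  simp only [translationOp, Matrix.of_apply, neg_eq_iff_eq_neg, neg_add, neg_neg]

theorem chargeC_mul_clockZ_mul_chargeC (j : ZMod L) :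
    chargeC N L * clockZ N L j * chargeC N L = (clockZ N L j)ᴴ := by
  ext m k
  rw [mul_chargeC_apply, chargeC_mul_apply, clockZ, Matrix.diagonal_conjTranspose,
    Matrix.diagonal_apply, Matrix.diagonal_apply]
  simp [AddChar.map_neg_eq_conj]

theorem conjTranspose_kwOp (A : Matrix (ZMod L) (ZMod L) (ZMod N)) :
    (kwOp A)ᴴ = kwOp Aᵀ * chargeC N L := by
  ext m k
  rw [mul_chargeC_apply, Matrix.conjTranspose_apply, kwOp_apply, kwOp_apply, Matrix.mulVec_neg,
    dotProduct_neg, neg_neg, Matrix.mulVec_transpose, dotProduct_comm m, ← Matrix.dotProduct_mulVec]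
  simp [AddChar.map_neg_eq_conj]

/-! ### The sum over the symmetry group -/

theorem symU_eq (f : ℤ → ZMod N) : (symU f : Op N L) = translationOp (toConfig N L f) :=
  prodX_eq _

/-- The product of sums of powers, expanded. The factors commute, so the expansion is carried out
in the group algebra of the configuration space. -/
theorem symSum_eq_sum {n : ℕ} (f : Fin n → ℤ → ZMod N) :
    (symSum f : Op N L) = ∑ a ∈ Fintype.piFinset fun _ : Fin n => Finset.range N,
      translationOp (∑ q, a q • toConfig N L (f q)) := by
  let φ := MonoidAlgebra.lift ℂ (Op N L) (Multiplicative (Config N L)) translationHom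
  have hφ : ∀ v : Config N L, φ (MonoidAlgebra.of ℂ _ (Multiplicative.ofAdd v)) = translationOp v :=
    fun v => by
      simp only [φ, MonoidAlgebra.lift_of]
      rfl
  have key : (symSum f : Op N L) = φ (∏ q, ∑ a ∈ Finset.range N,
      MonoidAlgebra.of ℂ _ (Multiplicative.ofAdd (toConfig N L (f q))) ^ a) := by
    rw [← List.prod_ofFn, map_list_prod, List.map_ofFn]
    simp only [symSum, symU_eq, Function.comp_def, map_sum, map_pow, hφ]
  rw [key, Finset.prod_univ_sum, map_sum]
  refine Finset.sum_congr rfl fun a _ => ?_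
  simp only [← map_pow, ← map_prod, ← ofAdd_nsmul, ← ofAdd_sum, hφ]

/-- The sum over the symmetry group is the indicator of the kernel of `Δ`: the normalized
generators parametrize that kernel bijectively by their coefficients modulo `N`. -/
theorem symSum_apply {n : ℕ} {Δ : Matrix (ZMod L) (ZMod L) (ZMod N)}
    (hΔ : IsCoupling n Δ) (hnL : n < L) {f : Fin n → ℤ → ZMod N} (hf : IsGeneratingFamily Δ f)
    (hper : ∀ (q : Fin n) (j : ℤ), f q (j + (L : ℤ)) = f q j) (m k : Config N L) :
    (symSum f : Op N L) m k = if Δ *ᵥ (m - k) = 0 then 1 else 0 := by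
  have hker : ∀ a : Fin n → ℕ, Δ *ᵥ (∑ q, a q • toConfig N L (f q)) = 0 := fun a => by
    rw [Matrix.mulVec_sum]
    refine Finset.sum_eq_zero fun q _ => ?_
    rw [Matrix.mulVec_smul, hf.mulVec_toConfig hΔ hnL hper, smul_zero]
  rw [symSum_eq_sum, Matrix.sum_apply]
  simp only [translationOp, Matrix.of_apply]
  split_ifs with h
  · -- The only contributing coefficients are the values of `m - k` on the sites `1, …, n`.
    rw [Finset.sum_eq_single fun i : Fin n => ((m - k) ((i.val + 1 : ℕ) : ZMod L)).val]
    · rw [if_pos]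
      rw [← sub_eq_iff_eq_add', ← sub_eq_zero]
      refine hΔ.eq_zero_of_mulVec_eq_zero hnL ?_ fun i => ?_
      · rw [Matrix.mulVec_sub, h, hker, sub_zero]
      · rw [Pi.sub_apply, hf.sum_nsmul_initial hper, ZMod.natCast_zmod_val, sub_self]
    · intro a ha hne
      refine if_neg fun hm => hne (funext fun i => ?_)
      have hi := hf.sum_nsmul_initial hper a i
      rw [← sub_eq_iff_eq_add'.2 hm] at hi
      rw [hi, ZMod.val_natCast,
        Nat.mod_eq_of_lt (Finset.mem_range.1 (Fintype.mem_piFinset.1 ha i))]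
    · intro hn
      exact absurd (Fintype.mem_piFinset.2 fun i => Finset.mem_range.2 (ZMod.val_lt _)) hn
  · refine Finset.sum_eq_zero fun a _ => if_neg fun hm => h ?_
    rw [sub_eq_iff_eq_add'.2 hm, hker]

/-! ### The non-invertible reflection -/

/-- The reflection turns the Kramers-Wannier operator into another operator of the same form, now
with a symmetric coupling matrix when `Δ` is translation invariant. -/
theorem dualRefl_eq_kwOp (Δ : Matrix (ZMod L) (ZMod L) (ZMod N)) :
    dualRefl Δ = kwOp (reflectedCoupling Δ) := by
  ext m k
  rw [dualRefl, Matrix.mul_apply, Finset.sum_eq_single (fun j => m (-j))]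
  · simp only [reflM, Matrix.of_apply, neg_neg, if_true, one_mul, kwOp]
    congr 3
    rw [← Equiv.sum_comp (Equiv.neg (ZMod L))]
    simp [reflectedCoupling]
  · intro b _ hb
    have : m ≠ fun j => b (-j) := fun h => hb (by simp [h])
    simp [reflM, this]
  · simp

theorem dualRefl_mul_self {n : ℕ} {Δ : Matrix (ZMod L) (ZMod L) (ZMod N)}
    (hΔ : IsCoupling n Δ) (hnL : n < L) {f : Fin n → ℤ → ZMod N} (hf : IsGeneratingFamily Δ f)
    (hper : ∀ (q : Fin n) (j : ℤ), f q (j + (L : ℤ)) = f q j) :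
    dualRefl Δ * dualRefl Δ = chargeC N L * symSum f := by
  ext m k
  rw [chargeC_mul_apply, symSum_apply hΔ hnL hf hper, dualRefl_eq_kwOp, kwOp_mul_kwOp_apply,
    ← Matrix.mulVec_transpose, hΔ.transpose_reflectedCoupling, ← Matrix.mulVec_add,
    ← neg_add', Matrix.mulVec_neg]
  simp only [neg_eq_zero, reflectedCoupling_mulVec_eq_zero_iff]

theorem dualRefl_mul_prodZ (Δ : Matrix (ZMod L) (ZMod L) (ZMod N)) (j : ZMod L) :
    dualRefl Δ * prodZ (Δ j) = shiftX N L (-j) * dualRefl Δ := by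
  rw [dualRefl_eq_kwOp, ← (implementsKW_kwOp (reflectedCoupling Δ)).1 (-j)]
  congr 2
  ext l
  simp [reflectedCoupling]

theorem IsCoupling.dualRefl_mul_shiftX {n : ℕ} {Δ : Matrix (ZMod L) (ZMod L) (ZMod N)}
    (hΔ : IsCoupling n Δ) (j : ZMod L) :
    dualRefl Δ * shiftX N L j = prodZ (fun l => -Δ (-j) l) * dualRefl Δ := by
  rw [dualRefl_eq_kwOp, (implementsKW_kwOp (reflectedCoupling Δ)).2 j,
    hΔ.transpose_reflectedCoupling]
  rfl

/-- `D_M` exchanges the two families of terms of the Hamiltonian and their adjoints, up to the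
reflection `j ↦ -j`, which only permutes the sum over sites. -/
theorem IsCoupling.commute_hamiltonian {n : ℕ} {Δ : Matrix (ZMod L) (ZMod L) (ZMod N)}
    (hΔ : IsCoupling n Δ) (J : ℝ) : Commute (dualRefl Δ) (hamiltonian Δ J J) := by
  set D := dualRefl Δ with hD
  have h1 : ∀ j, D * prodZ (Δ j) = shiftX N L (-j) * D := dualRefl_mul_prodZ Δ
  have h2 : ∀ j, D * shiftX N L j = (prodZ (Δ (-j)))ᴴ * D := fun j => by
    rw [conjTranspose_prodZ]
    exact hΔ.dualRefl_mul_shiftX j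
  have h3 : ∀ j, D * (prodZ (Δ j))ᴴ = (shiftX N L (-j))ᴴ * D := fun j => by
    rw [shiftX_eq, conjTranspose_translationOp, conjTranspose_prodZ, hD, dualRefl_eq_kwOp,
      translationOp_mul_kwOp, Matrix.neg_vecMul, Matrix.single_one_vecMul]
    congr 3
    ext l
    simp [reflectedCoupling]
  have h4 : ∀ j, D * (shiftX N L j)ᴴ = prodZ (Δ (-j)) * D := fun j => by
    rw [shiftX_eq, conjTranspose_translationOp, hD, dualRefl_eq_kwOp, kwOp_mul_translationOp,
      Matrix.mulVec_neg, neg_neg, Matrix.mulVec_single_one, ← hΔ.transpose_reflectedCoupling]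
    rfl
  rw [hamiltonian]
  refine Commute.neg_right ?_
  rw [Commute, SemiconjBy, Finset.mul_sum, Finset.sum_mul, ← Equiv.sum_comp (Equiv.neg (ZMod L))
    fun j => _ * D]
  refine Finset.sum_congr rfl fun j _ => ?_
  simp only [Matrix.conjTranspose_add, Matrix.conjTranspose_smul, mul_add, add_mul, mul_smul_comm,
    smul_mul_assoc, h1, h2, h3, h4, Equiv.neg_apply, Complex.star_def, Complex.conj_ofReal]
  abel

end ModulatedIsing

theorem mainTheorem6 (N L n : ℕ) [NeZero N] [NeZero L] (hN : 2 ≤ N) (hnL : n < L)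
    (Δ : Matrix (ZMod L) (ZMod L) (ZMod N)) (hΔ : IsCoupling n Δ)
    (f : Fin n → ℤ → ZMod N) (hf : IsGeneratingFamily Δ f)
    (hper : ∀ (q : Fin n) (j : ℤ), f q (j + (L : ℤ)) = f q j) :
    -- the Kramers-Wannier operator implements the duality, and is unique up to a scalar
    (ImplementsKW Δ (kwOp Δ) ∧
      ∀ D : Op N L, ImplementsKW Δ D → ∃ c : ℂ, D = c • kwOp Δ) ∧
    -- action of the non-invertible reflection on the local symmetric operators
    (∀ j : ZMod L, dualRefl Δ * prodZ (Δ j) = shiftX N L (-j) * dualRefl Δ) ∧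
    (∀ j : ZMod L,
      dualRefl Δ * shiftX N L j = prodZ (fun l => -Δ (-j) l) * dualRefl Δ) ∧
    -- it commutes with the Hamiltonian at `J = h`
    (∀ J h : ℝ, J = h → Commute (dualRefl Δ) (hamiltonian Δ J h)) ∧
    -- fusion algebra
    dualRefl Δ * dualRefl Δ = chargeC N L * symSum f ∧
    (dualRefl Δ)ᴴ = dualRefl Δ * chargeC N L ∧
    (∀ q : Fin n, symU (f q) * dualRefl Δ = dualRefl Δ ∧
      dualRefl Δ * symU (f q) = dualRefl Δ) ∧
    -- `C` is charge conjugation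
    (chargeC N L * (chargeC N L)ᴴ = 1 ∧
      ∀ j : ZMod L, chargeC N L * shiftX N L j * (chargeC N L)ᴴ = (shiftX N L j)ᴴ ∧
        chargeC N L * clockZ N L j * (chargeC N L)ᴴ = (clockZ N L j)ᴴ) ∧
    -- non-invertibility, as soon as there is a symmetry
    (0 < n → ¬ IsUnit (dualRefl Δ)) := by
  have hU : ∀ q : Fin n, symU (f q) * dualRefl Δ = dualRefl Δ ∧
      dualRefl Δ * symU (f q) = dualRefl Δ := fun q => by
    have h := reflectedCoupling_mulVec_eq_zero_iff.2 (hf.mulVec_toConfig hΔ hnL hper q)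
    rw [symU_eq, dualRefl_eq_kwOp, translationOp_mul_kwOp, kwOp_mul_translationOp,
      ← Matrix.mulVec_transpose, hΔ.transpose_reflectedCoupling, h, neg_zero, prodZ_zero, mul_one,
      one_mul]
    exact ⟨rfl, rfl⟩
  refine ⟨⟨implementsKW_kwOp Δ, fun D => eq_smul_kwOp_of_implementsKW⟩, dualRefl_mul_prodZ Δ,
    hΔ.dualRefl_mul_shiftX, ?_, dualRefl_mul_self hΔ hnL hf hper, ?_, hU, ⟨?_, fun j => ⟨?_, ?_⟩⟩,
    fun hn hD => ?_⟩
  · rintro J _ rfl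
    exact hΔ.commute_hamiltonian J
  · rw [dualRefl_eq_kwOp, conjTranspose_kwOp, hΔ.transpose_reflectedCoupling]
  · rw [conjTranspose_chargeC, chargeC_mul_self]
  · rw [conjTranspose_chargeC, chargeC_mul_shiftX_mul_chargeC]
  · rw [conjTranspose_chargeC, chargeC_mul_clockZ_mul_chargeC]
  · -- An invertible `D_M` could be cancelled from `U D_M = D_M`, but `U` moves the qudit at site `1`.
    have : Fact (1 < N) := ⟨hN⟩
    have h1 : (symU (f ⟨0, hn⟩) : Op N L) = 1 :=
      hD.mul_right_cancel ((hU ⟨0, hn⟩).1.trans (one_mul _).symm)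
    rw [symU_eq] at h1
    refine translationOp_ne_one (fun h0 => ?_) h1
    have := hf.toConfig_initial hper ⟨0, hn⟩ ⟨0, hn⟩
    simp [h0] at this
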